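/- Let $\mathcal A\in\mathbb R^{n_\chi\times n_\chi}$, $\mathcal B\in\mathbb R^{n_\chi\times n_w}$, $\mathcal C\in\mathbb R^{n_z\times n_\chi}$, $\mathcal D\in\mathbb R^{n_z\times n_w}$ be real matrices, let $\gamma\in\mathbb R$, and let $\Sigma_{\mathrm{nom}}=\int vv^\top\,d\mathbb P_{\mathrm{nom}}(v)$ be the second moment matrix of a zero-mean (possibly degenerate) normal distribution $\mathbb P_{\mathrm{nom}}$ on $\mathbb R^{n_w}$. Suppose that $\mathcal A$ is stable, i.e. all its complex eigenvalues have modulus less than $1$. The moment relaxation for correlated disturbances is the problem of maximizing $$\operatorname{tr}\Big(\begin{pmatrix}\mathcal C&\mathcal D&0\end{pmatrix}\Sigma\begin{pmatrix}\mathcal C&\mathcal D&0\end{pmatrix}^\top\Big)$$ over all real symmetric matrices $\Sigma=\begin{pmatrix}\Sigma_{\chi\chi}&\Sigma_{\chi w}&\Sigma_{\chi\hat w}\\ \Sigma_{w\chi}&\Sigma_{ww}&\Sigma_{w\hat w}\\ \Sigma_{\hat w\chi}&\Sigma_{\hat ww}&\Sigma_{\hat w\hat w}\end{pmatrix}\succeq0$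 (block sizes $n_\chi,n_w,n_w$) subject to $$\Sigma_{\chi\chi}=\begin{pmatrix}\mathcal A&\mathcal B&0\end{pmatrix}\Sigma\begin{pmatrix}\mathcal A&\mathcal B&0\end{pmatrix}^\top,\qquad \gamma^2\ge\operatorname{tr}\left(\begin{pmatrix}\Sigma_{ww}&\Sigma_{w\hat w}\\ \Sigma_{\hat ww}&\Sigma_{\hat w\hat w}\end{pmatrix}\begin{pmatrix}I&-I\\-I&I\end{pmatrix}\right),\qquad \Sigma_{\hat w\hat w}=\Sigma_{\mathrm{nom}}.$$ The dual analysis problem is the problem of minimizing $\operatorname{tr}(Q\Sigma_{\mathrm{nom}})+\lambda\gamma^2$ over $\lambda\ge0$ and symmetric matrices $\mathcal P\in\mathbb R^{n_\chi\times n_\chi}$, $Q\in\mathbb R^{n_w\times n_w}$ subject to the strict matrix inequality $$\begin{pmatrix}I&0&0\\ \mathcal A&\mathcal B&0\\ \mathcal C&\mathcal D&0\\0&I&0\\0&0&I\end{pmatrix}^{\!\top}\begin{pmatrix}-\mathcal P&0&0&0&0\\0&\mathcal P&0&0&0\\0&0&I&0&0\\0&0&0&-\lambda I&\lambda I\\0&0&0&\lambda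 I&-Q-\lambda I\end{pmatrix}\begin{pmatrix}I&0&0\\ \mathcal A&\mathcal B&0\\ \mathcal C&\mathcal D&0\\0&I&0\\0&0&I\end{pmatrix}\prec0.$$ Then the two problems are equivalent: the supremum of the moment relaxation and the infimum of the dual analysis problem are finite and equal. Moreover, the dual analysis problem is feasible. -/

import Mathlib

open Matrix MeasureTheory

noncomputable section

namespace DRControl

variable {ι κ ζ : Type*} [Fintype ι] [DecidableEq ι] [Fintype κ] [DecidableEq κ]
  [Fintype ζ] [DecidableEq ζ]

/-- Stability of the discrete-time system `χ(t+1) = A χ(t)`: every complex eigenvalue of `A`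
has modulus less than one. -/
def IsStable (A : Matrix ι ι ℝ) : Prop :=
  ∀ μ ∈ spectrum ℂ (A.map (algebraMap ℝ ℂ)), ‖μ‖ < 1

/-- The second moment matrix `∫ v vᵀ dμ(v)` of a distribution `μ` on Euclidean space. -/
def secondMoment (μ : Measure (EuclideanSpace ℝ κ)) : Matrix κ κ ℝ :=
  Matrix.of fun i j => ∫ v, v i * v j ∂μ

/-! Moment matrices are indexed by `ι ⊕ κ ⊕ κ`; the three blocks belong to the state `χ`,
the disturbance `w` and the nominal disturbance `ŵ`, in this order. -/

/-- The block row `(I 0 0)`, selecting the state `χ`. -/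
def rowState (ι κ : Type*) [DecidableEq ι] : Matrix ι (ι ⊕ κ ⊕ κ) ℝ := fromCols 1 (fromCols 0 0)

/-- The block row `(0 I 0)`, selecting the disturbance `w`. -/
def rowDist (ι κ : Type*) [DecidableEq κ] : Matrix κ (ι ⊕ κ ⊕ κ) ℝ := fromCols 0 (fromCols 1 0)

/-- The block row `(0 0 I)`, selecting the nominal disturbance `ŵ`. -/
def rowNom (ι κ : Type*) [DecidableEq κ] : Matrix κ (ι ⊕ κ ⊕ κ) ℝ := fromCols 0 (fromCols 0 1)

/-- The block row `(A B 0)`, the dynamics. -/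
def rowDyn (A : Matrix ι ι ℝ) (B : Matrix ι κ ℝ) : Matrix ι (ι ⊕ κ ⊕ κ) ℝ :=
  fromCols A (fromCols B 0)

/-- The block row `(C D 0)`, the performance output. -/
def rowOut (C : Matrix ζ ι ℝ) (D : Matrix ζ κ ℝ) : Matrix ζ (ι ⊕ κ ⊕ κ) ℝ :=
  fromCols C (fromCols D 0)

/-- The set of moment matrices for correlated disturbances: full `3 × 3` block matrices,
no block is required to vanish. -/
def momentSetCor : Set (Matrix (ι ⊕ κ ⊕ κ) (ι ⊕ κ ⊕ κ) ℝ) := Set.univ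

/-- Objective of the moment relaxation: `tr ((C D 0) Σ (C D 0)ᵀ)`. -/
def momentObjective (C : Matrix ζ ι ℝ) (D : Matrix ζ κ ℝ)
    (M : Matrix (ι ⊕ κ ⊕ κ) (ι ⊕ κ ⊕ κ) ℝ) : ℝ :=
  trace (rowOut C D * M * (rowOut C D)ᵀ)

/-- Feasibility for the moment relaxation with structural constraint set `S`. -/
structure MomentFeasible (S : Set (Matrix (ι ⊕ κ ⊕ κ) (ι ⊕ κ ⊕ κ) ℝ))
    (A : Matrix ι ι ℝ) (B : Matrix ι κ ℝ) (Snom : Matrix κ κ ℝ) (γ : ℝ)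
    (M : Matrix (ι ⊕ κ ⊕ κ) (ι ⊕ κ ⊕ κ) ℝ) : Prop where
  mem : M ∈ S
  stationary : rowState ι κ * M * (rowState ι κ)ᵀ = rowDyn A B * M * (rowDyn A B)ᵀ
  transport : γ ^ 2 ≥ trace
    (fromRows (rowDist ι κ) (rowNom ι κ) * M * (fromRows (rowDist ι κ) (rowNom ι κ))ᵀ
      * fromBlocks 1 (-1) (-1) 1)
  nominal : Snom = rowNom ι κ * M * (rowNom ι κ)ᵀ
  posSemidef : M.PosSemidef

/-- The middle factor `diag(-P, P, I, [[-λ I, λ I], [λ I, -Q - λ I]])` of the LMI. -/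
def lmiMiddle (ζ : Type*) [DecidableEq ζ] (l : ℝ) (P : Matrix ι ι ℝ) (Q : Matrix κ κ ℝ) :
    Matrix (ι ⊕ ι ⊕ ζ ⊕ κ ⊕ κ) (ι ⊕ ι ⊕ ζ ⊕ κ ⊕ κ) ℝ :=
  fromBlocks (-P) 0 0 (fromBlocks P 0 0 (fromBlocks 1 0 0
    (fromBlocks (-(l • 1)) (l • 1) (l • 1) (-Q - l • 1))))

/-- The outer factor of the LMI, with block rows `(I 0 0)`, `(A B 0)`, `(C D 0)`, `(0 I 0)`,
`(0 0 I)`. -/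
def lmiOuter (A : Matrix ι ι ℝ) (B : Matrix ι κ ℝ) (C : Matrix ζ ι ℝ) (D : Matrix ζ κ ℝ) :
    Matrix (ι ⊕ ι ⊕ ζ ⊕ κ ⊕ κ) (ι ⊕ κ ⊕ κ) ℝ :=
  fromRows (rowState ι κ) (fromRows (rowDyn A B) (fromRows (rowOut C D)
    (fromRows (rowDist ι κ) (rowNom ι κ))))

/-- Feasibility for the dual analysis problem in the variables `l = λ`, `P`, `Q`: `λ ≥ 0`,
`P` and `Q` symmetric, and the strict LMI `outerᵀ * middle * outer ≺ 0`. -/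
structure DualFeasible (A : Matrix ι ι ℝ) (B : Matrix ι κ ℝ) (C : Matrix ζ ι ℝ)
    (D : Matrix ζ κ ℝ) (l : ℝ) (P : Matrix ι ι ℝ) (Q : Matrix κ κ ℝ) : Prop where
  nonneg : 0 ≤ l
  symm_P : P.IsSymm
  symm_Q : Q.IsSymm
  lmi : (-((lmiOuter A B C D)ᵀ * lmiMiddle ζ l P Q * lmiOuter A B C D)).PosDef

/-- Objective of the dual analysis problem: `tr (Q Σ_nom) + λ γ²`. -/
def dualObjective (Snom : Matrix κ κ ℝ) (γ : ℝ) (l : ℝ) (Q : Matrix κ κ ℝ) : ℝ :=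
  trace (Q * Snom) + l * γ ^ 2

end DRControl

end

open Filter Topology

namespace DRControl

/-! ### Stable matrices and the discrete Lyapunov equation. -/

section Lyapunov

/-! This is semidefinite programming duality with a Slater point on the dual side. The identity
`trace_mul_lmi` shows that pairing a moment matrix with the dual inequality gives the Lagrangian, so
`weak_duality` follows from nonnegativity of the trace of a product of positive semidefinite
matrices.

Stability makes both problems feasible through convergent Lyapunov series: a stationary state
covariance gives a moment matrix with `w = ŵ`, and a multiple of the solution of `P = I + Aᵀ P A`,
with large `λ` and `Q`, satisfies the strict inequality. Weak duality then makes both values finite.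

To close the gap (`exists_momentFeasible_of_forall_le`), let `v` be a lower bound for the dual. The
point `(0, v)` lies outside the open convex set `dualEpigraph`, and Hahn–Banach separates them. The
separating functional is a pair `(M, μ)`; strict dual feasibility forces `μ > 0`, and `μ⁻¹ • M` is a
feasible moment matrix of value at least `v`. The distribution enters only through the positive
semidefiniteness of its second moment. -/

theorem posSemidef_tsum {ι : Type*} [Fintype ι] {f : ℕ → Matrix ι ι ℝ} (hf : Summable f) (h : ∀ k, (f k).PosSemidef) :
    (∑' k, f k).PosSemidef := by
  refine .of_dotProduct_mulVec_nonneg ?_ fun x => ?_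
  · rw [IsHermitian, conjTranspose_tsum]
    exact tsum_congr fun k => (h k).1
  · have hc : Continuous fun M : Matrix ι ι ℝ => star x ⬝ᵥ (M *ᵥ x) := by fun_prop
    refine ge_of_tendsto (hc.tendsto _ |>.comp hf.hasSum) (Eventually.of_forall fun s => ?_)
    exact (posSemidef_sum s fun k _ => h k).dotProduct_mulVec_nonneg x

variable {ι : Type*} [Fintype ι] [DecidableEq ι]

open scoped Matrix.Norms.L2Operator ENNReal NNReal in
/-- If the spectral radius of `a` is less than one, then `∑ aᵏ y (aᵏ)ᴴ` converges. -/
theorem summable_pow_mul_mul_conjTranspose_pow (a y : Matrix ι ι ℂ)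
    (ha : ∀ μ ∈ spectrum ℂ a, ‖μ‖ < 1) :
    Summable fun k : ℕ => a ^ k * y * (a ^ k)ᴴ := by
  cases isEmpty_or_nonempty ι with
  | inl h => exact (summable_zero).congr fun k => Subsingleton.elim _ _
  | inr h =>
    have hlt : spectralRadius ℂ a < (1 : ℝ≥0) :=
      spectrum.spectralRadius_lt_of_forall_lt a fun z hz => by
        simpa [← NNReal.coe_lt_coe] using ha z hz
    obtain ⟨r, hr, hr1⟩ := ENNReal.lt_iff_exists_nnreal_btwn.1 hlt
    have hr1' : r < 1 := by exact_mod_cast hr1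
    -- Gelfand's formula gives `‖aᵏ‖ ≤ rᵏ` eventually, for some `r < 1` above the spectral radius.
    have hev := (spectrum.pow_nnnorm_pow_one_div_tendsto_nhds_spectralRadius a).eventually
      (gt_mem_nhds hr)
    have hbound : ∀ᶠ k : ℕ in atTop, ‖a ^ k‖ ≤ (r : ℝ) ^ k := by
      filter_upwards [hev, eventually_gt_atTop 0] with k hk hk0
      have hk' : (k : ℝ) ≠ 0 := by positivity
      have h1 := ENNReal.rpow_le_rpow hk.le (z := (k : ℝ)) (by positivity)
      rw [← ENNReal.rpow_mul, one_div, inv_mul_cancel₀ hk', ENNReal.rpow_one,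
        ENNReal.rpow_natCast] at h1
      exact_mod_cast h1
    refine Summable.of_norm_bounded_eventually_nat
      (g := fun k => ‖y‖ * (r : ℝ) ^ k) ?_ ?_
    · exact (summable_geometric_of_lt_one r.2 (by exact_mod_cast hr1')).mul_left _
    · filter_upwards [hbound] with k hk
      have hrk : (r : ℝ) ^ k ≤ 1 := pow_le_one₀ r.2 (by exact_mod_cast hr1'.le)
      have hst : ‖(a ^ k)ᴴ‖ = ‖a ^ k‖ := norm_star _
      calc ‖a ^ k * y * (a ^ k)ᴴ‖ ≤ ‖a ^ k‖ * ‖y‖ * ‖(a ^ k)ᴴ‖ :=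
            (norm_mul_le _ _).trans (by gcongr; exact norm_mul_le _ _)
        _ ≤ (r : ℝ) ^ k * ‖y‖ * 1 := by rw [hst]; gcongr; exact hk.trans hrk
        _ = ‖y‖ * (r : ℝ) ^ k := by ring

theorem IsStable.summable {A : Matrix ι ι ℝ} (hA : IsStable A) (Y : Matrix ι ι ℝ) :
    Summable fun k : ℕ => A ^ k * Y * (A ^ k)ᵀ := by
  have h := summable_pow_mul_mul_conjTranspose_pow (A.map (algebraMap ℝ ℂ))
    (Y.map (algebraMap ℝ ℂ)) hA
  have he : ∀ k : ℕ, (A.map (algebraMap ℝ ℂ)) ^ k * Y.map (algebraMap ℝ ℂ) *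
      ((A.map (algebraMap ℝ ℂ)) ^ k)ᴴ = (A ^ k * Y * (A ^ k)ᵀ).map (algebraMap ℝ ℂ) := by
    intro k
    have hp : (A.map (algebraMap ℝ ℂ)) ^ k = (A ^ k).map (algebraMap ℝ ℂ) :=
      (map_pow (algebraMap ℝ ℂ).mapMatrix A k).symm
    rw [hp, Matrix.map_mul, Matrix.map_mul]
    congr 1
    ext i j
    simp [-transpose_pow]
  simp only [he] at h
  refine Pi.summable.2 fun i => Pi.summable.2 fun j => ?_
  have hij := Pi.summable.1 (Pi.summable.1 h i) j
  exact Complex.summable_ofReal.1 hij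

/-- Needed because the dual certificate solves the Lyapunov equation of `Aᵀ`, the moment matrix that
of `A`. -/
theorem IsStable.transpose {A : Matrix ι ι ℝ} (hA : IsStable A) : IsStable Aᵀ := by
  intro μ hμ
  apply hA μ
  rw [Matrix.mem_spectrum_iff_isRoot_charpoly] at hμ ⊢
  rwa [Matrix.transpose_map, Matrix.charpoly_transpose] at hμ

/-- The discrete Lyapunov equation of a stable matrix has a positive semidefinite solution. -/
theorem IsStable.exists_lyapunov {A : Matrix ι ι ℝ} (hA : IsStable A) {Y : Matrix ι ι ℝ}
    (hY : Y.PosSemidef) : ∃ X : Matrix ι ι ℝ, X.PosSemidef ∧ X = Y + A * X * Aᵀ := by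
  have hs := hA.summable Y
  refine ⟨∑' k : ℕ, A ^ k * Y * (A ^ k)ᵀ, posSemidef_tsum hs fun k => ?_, ?_⟩
  · simpa using hY.mul_mul_conjTranspose_same (A ^ k)
  · conv_lhs => rw [hs.tsum_eq_zero_add]
    rw [← hs.tsum_mul_left, ← (hs.mul_left A).tsum_mul_right]
    congr 1
    · simp
    · refine tsum_congr fun k => ?_
      rw [pow_succ', transpose_mul]
      simp only [Matrix.mul_assoc]

end Lyapunov

end DRControl

namespace DRControl

/-! ### Block algebra of the matrix inequality and its trace pairing. -/

section Blocks

variable {ι κ ζ : Type*} [Fintype ι] [DecidableEq ι] [Fintype κ] [DecidableEq κ]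
  [Fintype ζ] [DecidableEq ζ]

/-- The block row `(0 I -I)`. -/
def rowDiff (ι κ : Type*) [DecidableEq κ] : Matrix κ (ι ⊕ κ ⊕ κ) ℝ := rowDist ι κ - rowNom ι κ

/-- The left-hand side of the matrix inequality of the dual analysis problem. -/
def lmi (A : Matrix ι ι ℝ) (B : Matrix ι κ ℝ) (C : Matrix ζ ι ℝ) (D : Matrix ζ κ ℝ)
    (l : ℝ) (P : Matrix ι ι ℝ) (Q : Matrix κ κ ℝ) : Matrix (ι ⊕ κ ⊕ κ) (ι ⊕ κ ⊕ κ) ℝ :=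
  (lmiOuter A B C D)ᵀ * lmiMiddle ζ l P Q * lmiOuter A B C D

theorem lmi_eq (A : Matrix ι ι ℝ) (B : Matrix ι κ ℝ) (C : Matrix ζ ι ℝ) (D : Matrix ζ κ ℝ)
    (l : ℝ) (P : Matrix ι ι ℝ) (Q : Matrix κ κ ℝ) :
    lmi A B C D l P Q =
      (rowDyn A B)ᵀ * P * rowDyn A B - (rowState ι κ)ᵀ * P * rowState ι κ
        + (rowOut C D)ᵀ * rowOut C D - l • ((rowDiff ι κ)ᵀ * rowDiff ι κ)
        - (rowNom ι κ)ᵀ * Q * rowNom ι κ := by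
  simp only [lmi, lmiOuter, lmiMiddle, transpose_fromRows, fromCols_mul_fromBlocks, fromCols_mul_fromRows,
    Matrix.mul_zero, Matrix.mul_one, add_zero, zero_add, rowDiff, transpose_sub, Matrix.sub_mul,
    Matrix.mul_sub, Matrix.mul_neg, Matrix.neg_mul, Matrix.add_mul, Matrix.mul_smul,
    Matrix.smul_mul, smul_sub]
  abel

theorem trace_mul_gram {m n : Type*} [Fintype m] [Fintype n] (M : Matrix n n ℝ)
    (G : Matrix m n ℝ) : trace (M * (Gᵀ * G)) = trace (G * M * Gᵀ) := by
  rw [← Matrix.mul_assoc, trace_mul_comm, ← Matrix.mul_assoc]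

theorem trace_mul_congruence {m n : Type*} [Fintype m] [Fintype n] (M : Matrix n n ℝ)
    (G : Matrix m n ℝ) (K : Matrix m m ℝ) :
    trace (M * (Gᵀ * K * G)) = trace (K * (G * M * Gᵀ)) := by
  rw [← Matrix.mul_assoc, trace_mul_comm, ← Matrix.mul_assoc, ← Matrix.mul_assoc, trace_mul_comm]

/-- The weight is the Gram matrix of `(I -I)`, so the transport cost is the second moment of `w -
ŵ`. -/
theorem trace_transport_eq (M : Matrix (ι ⊕ κ ⊕ κ) (ι ⊕ κ ⊕ κ) ℝ) :
    trace (fromRows (rowDist ι κ) (rowNom ι κ) * M * (fromRows (rowDist ι κ) (rowNom ι κ))ᵀ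
      * fromBlocks 1 (-1) (-1) 1) = trace (rowDiff ι κ * M * (rowDiff ι κ)ᵀ) := by
  rw [trace_mul_comm, ← trace_mul_congruence, ← trace_mul_gram]
  congr 2
  simp only [transpose_fromRows, fromCols_mul_fromBlocks, fromCols_mul_fromRows, rowDiff,
    transpose_sub, Matrix.sub_mul, Matrix.mul_sub, Matrix.mul_neg, Matrix.mul_one, Matrix.add_mul,
    Matrix.neg_mul]
  abel

/-- The Lagrangian identity of the moment relaxation. -/
theorem trace_mul_lmi (A : Matrix ι ι ℝ) (B : Matrix ι κ ℝ) (C : Matrix ζ ι ℝ)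
    (D : Matrix ζ κ ℝ) (l : ℝ) (P : Matrix ι ι ℝ) (Q : Matrix κ κ ℝ)
    (M : Matrix (ι ⊕ κ ⊕ κ) (ι ⊕ κ ⊕ κ) ℝ) :
    trace (M * lmi A B C D l P Q) =
      trace (P * (rowDyn A B * M * (rowDyn A B)ᵀ - rowState ι κ * M * (rowState ι κ)ᵀ))
        + momentObjective C D M - l * trace (rowDiff ι κ * M * (rowDiff ι κ)ᵀ)
        - trace (Q * (rowNom ι κ * M * (rowNom ι κ)ᵀ)) := by
  rw [lmi_eq, Matrix.mul_sub, Matrix.mul_sub, Matrix.mul_add, Matrix.mul_sub, trace_sub, trace_sub,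
    trace_add, trace_sub, trace_mul_congruence, trace_mul_congruence, trace_mul_congruence,
    Matrix.mul_smul, trace_smul, trace_mul_gram, trace_mul_gram, Matrix.mul_sub,
    trace_sub, momentObjective, smul_eq_mul]

theorem lmi_isSymm (A : Matrix ι ι ℝ) (B : Matrix ι κ ℝ) (C : Matrix ζ ι ℝ) (D : Matrix ζ κ ℝ)
    (l : ℝ) {P : Matrix ι ι ℝ} {Q : Matrix κ κ ℝ} (hP : P.IsSymm) (hQ : Q.IsSymm) :
    (lmi A B C D l P Q).IsSymm := by
  rw [lmi_eq]
  simp only [IsSymm, transpose_sub, transpose_add, transpose_mul, transpose_transpose,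
    transpose_smul, hP.eq, hQ.eq, Matrix.mul_assoc]

/-- The output term does not depend on the dual variables, so `lmi` is affine rather than linear;
hence the weights must sum to one. -/
theorem lmi_combination (A : Matrix ι ι ℝ) (B : Matrix ι κ ℝ) (C : Matrix ζ ι ℝ)
    (D : Matrix ζ κ ℝ) (l l' : ℝ) (P P' : Matrix ι ι ℝ) (Q Q' : Matrix κ κ ℝ) {a b : ℝ}
    (hab : a + b = 1) :
    lmi A B C D (a * l + b * l') (a • P + b • P') (a • Q + b • Q') =
      a • lmi A B C D l P Q + b • lmi A B C D l' P' Q' := by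
  obtain rfl : b = 1 - a := by linarith
  simp only [lmi_eq, Matrix.mul_add, Matrix.add_mul, Matrix.mul_smul, Matrix.smul_mul]
  module

end Blocks
end DRControl

namespace DRControl

/-! ### Feasible points of both problems. -/

section Slater

variable {ι κ ζ : Type*} [Fintype ι] [DecidableEq ι] [Fintype κ] [DecidableEq κ]
  [Fintype ζ] [DecidableEq ζ]

theorem dotProduct_self_nonneg_real {n : Type*} [Fintype n] (x : n → ℝ) : 0 ≤ x ⬝ᵥ x :=
  Finset.sum_nonneg fun i _ => mul_self_nonneg (x i)

/-- Cauchy–Schwarz in each row; the constant is the squared Frobenius norm. -/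
theorem exists_mulVec_dotProduct_self_le {m n : Type*} [Fintype m] [Fintype n]
    (G : Matrix m n ℝ) : ∃ c : ℝ, 0 ≤ c ∧ ∀ x, (G *ᵥ x) ⬝ᵥ (G *ᵥ x) ≤ c * (x ⬝ᵥ x) := by
  refine ⟨∑ i, ∑ j, G i j ^ 2, by positivity, fun x => ?_⟩
  rw [dotProduct, Finset.sum_mul]
  refine Finset.sum_le_sum fun i _ => ?_
  have := Finset.sum_mul_sq_le_sq_mul_sq Finset.univ (G i) x
  simpa [mulVec, dotProduct, sq] using this

theorem dotProduct_congruence_mulVec {m n : Type*} [Fintype m] [Fintype n] (G : Matrix m n ℝ)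
    (K : Matrix m m ℝ) (z : n → ℝ) :
    z ⬝ᵥ ((Gᵀ * K * G) *ᵥ z) = (G *ᵥ z) ⬝ᵥ (K *ᵥ (G *ᵥ z)) := by
  rw [← mulVec_mulVec, ← mulVec_mulVec, dotProduct_mulVec, vecMul_transpose]

theorem dotProduct_gram_mulVec {m n : Type*} [Fintype m] [Fintype n] (G : Matrix m n ℝ)
    (z : n → ℝ) : z ⬝ᵥ ((Gᵀ * G) *ᵥ z) = (G *ᵥ z) ⬝ᵥ (G *ᵥ z) := by
  rw [← mulVec_mulVec, dotProduct_mulVec, vecMul_transpose]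

theorem rowState_mulVec_elim (x : ι → ℝ) (w u : κ → ℝ) :
    rowState ι κ *ᵥ Sum.elim x (Sum.elim w u) = x := by
  simp [rowState, fromCols_mulVec]

theorem rowDyn_mulVec_elim (A : Matrix ι ι ℝ) (B : Matrix ι κ ℝ) (x : ι → ℝ) (w u : κ → ℝ) :
    rowDyn A B *ᵥ Sum.elim x (Sum.elim w u) = A *ᵥ x + B *ᵥ w := by
  simp [rowDyn, fromCols_mulVec]

theorem rowOut_mulVec_elim (C : Matrix ζ ι ℝ) (D : Matrix ζ κ ℝ) (x : ι → ℝ) (w u : κ → ℝ) :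
    rowOut C D *ᵥ Sum.elim x (Sum.elim w u) = C *ᵥ x + D *ᵥ w := by
  simp [rowOut, fromCols_mulVec]

theorem rowNom_mulVec_elim (x : ι → ℝ) (w u : κ → ℝ) :
    rowNom ι κ *ᵥ Sum.elim x (Sum.elim w u) = u := by
  simp [rowNom, fromCols_mulVec]

theorem rowDiff_mulVec_elim (x : ι → ℝ) (w u : κ → ℝ) :
    rowDiff ι κ *ᵥ Sum.elim x (Sum.elim w u) = w - u := by
  simp [rowDiff, sub_mulVec, rowDist, rowNom, fromCols_mulVec]

/-- The dual analysis problem of a stable system is feasible. -/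
theorem IsStable.exists_dualFeasible {A : Matrix ι ι ℝ} (hA : IsStable A) (B : Matrix ι κ ℝ)
    (C : Matrix ζ ι ℝ) (D : Matrix ζ κ ℝ) :
    ∃ (l : ℝ) (P : Matrix ι ι ℝ) (Q : Matrix κ κ ℝ), DualFeasible A B C D l P Q := by
  obtain ⟨P, hP, hlyap⟩ := hA.transpose.exists_lyapunov PosSemidef.one
  rw [transpose_transpose] at hlyap
  have hPs : Pᵀ = P := by simpa [IsHermitian] using hP.1
  obtain ⟨c₁, hc₁, h₁⟩ := exists_mulVec_dotProduct_self_le (Aᵀ * P * B)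
  obtain ⟨c₂, hc₂, h₂⟩ := exists_mulVec_dotProduct_self_le (Bᵀ * P * B)
  obtain ⟨c₃, hc₃, h₃⟩ := exists_mulVec_dotProduct_self_le C
  obtain ⟨c₄, hc₄, h₄⟩ := exists_mulVec_dotProduct_self_le D
  -- By Young's inequality the `P` and output terms are at most `(-α / 2 + 2 * c₃) |x|² + K |w|²`,
  -- and this `α` makes the first coefficient `-1`. Since `|w|² ≤ 2 |w - u|² + 2 |u|²`, taking `λ =
  -- 2 * K + 1` and `Q = λ I` leaves at most `-|x|² - |w - u|² - |u|²`.
  set α : ℝ := 4 * c₃ + 2 with hα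
  set K : ℝ := α * (2 * c₁ + 1 / 2 + c₂ / 2) + 2 * c₄ with hK
  have hα0 : 0 ≤ α := by positivity
  have hK0 : 0 ≤ K := by positivity
  have hsP : (α • P).IsSymm := by simp [IsSymm, hPs]
  have hsQ : ((2 * K + 1) • (1 : Matrix κ κ ℝ)).IsSymm := by simp [IsSymm]
  refine ⟨2 * K + 1, α • P, (2 * K + 1) • 1, by positivity, hsP, hsQ, ?_⟩
  refine .of_dotProduct_mulVec_pos ?_ fun z hz => ?_
  · rw [IsHermitian, conjTranspose_eq_transpose_of_trivial, transpose_neg]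
    exact congrArg Neg.neg (lmi_isSymm A B C D _ hsP hsQ).eq
  obtain ⟨x, w, u, rfl⟩ : ∃ (x : ι → ℝ) (w u : κ → ℝ), z = Sum.elim x (Sum.elim w u) :=
    ⟨fun i => z (.inl i), fun i => z (.inr (.inl i)), fun i => z (.inr (.inr i)), by
      ext (i | i | i) <;> rfl⟩
  change 0 < _ ⬝ᵥ ((-lmi A B C D _ _ _) *ᵥ _)
  rw [star_trivial, neg_mulVec, dotProduct_neg, lmi_eq]
  simp only [sub_mulVec, add_mulVec, dotProduct_sub, dotProduct_add, smul_mulVec, dotProduct_smul,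
    dotProduct_congruence_mulVec, dotProduct_gram_mulVec, rowState_mulVec_elim, rowDyn_mulVec_elim,
    rowOut_mulVec_elim, rowNom_mulVec_elim, rowDiff_mulVec_elim, one_mulVec, smul_eq_mul,
    mulVec_add, add_dotProduct]
  have e₁ : x ⬝ᵥ (P *ᵥ x) = x ⬝ᵥ x + (A *ᵥ x) ⬝ᵥ (P *ᵥ (A *ᵥ x)) := by
    conv_lhs => rw [hlyap]
    rw [add_mulVec, one_mulVec, dotProduct_add, dotProduct_congruence_mulVec]
  have e₂ : (A *ᵥ x) ⬝ᵥ (P *ᵥ (B *ᵥ w)) = x ⬝ᵥ ((Aᵀ * P * B) *ᵥ w) := by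
    rw [← mulVec_mulVec, ← mulVec_mulVec, dotProduct_mulVec x, vecMul_transpose]
  have e₃ : (B *ᵥ w) ⬝ᵥ (P *ᵥ (A *ᵥ x)) = x ⬝ᵥ ((Aᵀ * P * B) *ᵥ w) := by
    rw [← e₂, dotProduct_mulVec, ← mulVec_transpose, hPs, dotProduct_comm]
  have e₄ : (B *ᵥ w) ⬝ᵥ (P *ᵥ (B *ᵥ w)) = w ⬝ᵥ ((Bᵀ * P * B) *ᵥ w) := by
    rw [dotProduct_congruence_mulVec]
  rw [e₁, e₂, e₃, e₄]
  have g₁ := h₁ w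
  have g₂ := h₂ w
  have g₃ := h₃ x
  have g₄ := h₄ w
  set h := (Aᵀ * P * B) *ᵥ w
  set k := (Bᵀ * P * B) *ᵥ w
  set p := C *ᵥ x
  set q := D *ᵥ w
  have s₁ := dotProduct_self_nonneg_real (x - (2 : ℝ) • h)
  have s₂ := dotProduct_self_nonneg_real (w - k)
  have s₃ := dotProduct_self_nonneg_real (p - q)
  have s₄ := dotProduct_self_nonneg_real (w - (2 : ℝ) • u)
  simp only [sub_dotProduct, dotProduct_sub, smul_dotProduct, dotProduct_smul, smul_eq_mul,
    dotProduct_comm h x, dotProduct_comm k w, dotProduct_comm q p, dotProduct_comm u w]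
    at s₁ s₂ s₃ s₄ ⊢
  have hx := dotProduct_self_nonneg_real x
  have hu := dotProduct_self_nonneg_real u
  have hd := dotProduct_self_nonneg_real (w - u)
  simp only [sub_dotProduct, dotProduct_sub, dotProduct_comm u w] at hd
  have hpos : 0 < x ⬝ᵥ x + (w ⬝ᵥ w - w ⬝ᵥ u - (w ⬝ᵥ u - u ⬝ᵥ u)) + u ⬝ᵥ u := by
    refine lt_of_le_of_ne (by positivity) fun h0 => hz ?_
    have hx0 : x = 0 := dotProduct_self_eq_zero.1 (by linarith)
    have hu0 : u = 0 := dotProduct_self_eq_zero.1 (by linarith)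
    have hw0 : w = 0 := by
      subst hu0
      simp only [dotProduct_zero] at h0 hd
      exact dotProduct_self_eq_zero.1 (by linarith)
    subst hx0 hu0 hw0
    ext (i | i | i) <;> rfl
  have b₁ : 2 * (x ⬝ᵥ h) + w ⬝ᵥ k ≤ (x ⬝ᵥ x) / 2 + (2 * c₁ + 1 / 2 + c₂ / 2) * (w ⬝ᵥ w) := by
    linarith
  have b₂ := mul_le_mul_of_nonneg_left b₁ hα0
  have b₃ : w ⬝ᵥ w ≤ 2 * (w ⬝ᵥ w - w ⬝ᵥ u - (w ⬝ᵥ u - u ⬝ᵥ u)) + 2 * (u ⬝ᵥ u) := by linarith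
  have b₄ := mul_le_mul_of_nonneg_left b₃ hK0
  have b₅ : α * ((x ⬝ᵥ x) / 2) = 2 * c₃ * (x ⬝ᵥ x) + x ⬝ᵥ x := by rw [hα]; ring
  have b₆ : K * (w ⬝ᵥ w) = α * ((2 * c₁ + 1 / 2 + c₂ / 2) * (w ⬝ᵥ w)) + 2 * c₄ * (w ⬝ᵥ w) := by
    rw [hK]; ring
  linarith

/-- The second moment matrix of a Gaussian distribution is positive semidefinite. -/
theorem posSemidef_secondMoment (μ : Measure (EuclideanSpace ℝ κ))
    [ProbabilityTheory.IsGaussian μ] : (secondMoment μ).PosSemidef := by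
  have hL : ∀ i, MemLp (fun v : EuclideanSpace ℝ κ => v i) 2 μ := fun i =>
    (EuclideanSpace.proj (𝕜 := ℝ) i).comp_memLp' ProbabilityTheory.IsGaussian.memLp_two_id
  have hint : ∀ i j, Integrable (fun v : EuclideanSpace ℝ κ => v i * v j) μ := fun i j =>
    (hL i).integrable_mul (hL j)
  refine .of_dotProduct_mulVec_nonneg ?_ fun x => ?_
  · ext i j
    simp [secondMoment, mul_comm]
  · have : star x ⬝ᵥ (secondMoment μ *ᵥ x) = ∫ v : EuclideanSpace ℝ κ, (∑ i, x i * v i) ^ 2 ∂μ := by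
      have e : ∀ v : EuclideanSpace ℝ κ,
          (∑ i, x i * v i) ^ 2 = ∑ i, ∑ j, x i * x j * (v i * v j) := by
        intro v
        rw [sq, Finset.sum_mul_sum]
        exact Finset.sum_congr rfl fun i _ => Finset.sum_congr rfl fun j _ => by ring
      simp only [e]
      rw [integral_finsetSum _ fun i _ => integrable_finsetSum _ fun j _ => (hint i j).const_mul _]
      refine Finset.sum_congr rfl fun i _ => ?_
      rw [integral_finsetSum _ fun j _ => (hint i j).const_mul _, mulVec, dotProduct,
        Finset.mul_sum]
      refine Finset.sum_congr rfl fun j _ => ?_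
      rw [integral_const_mul]
      simp only [secondMoment, of_apply, star_trivial]
      ring
    rw [this]
    exact integral_nonneg fun v => sq_nonneg _

theorem congruence_add_congruence {m n p q : Type*} [Fintype m] [Fintype n] [Fintype p]
    [Fintype q] (R : Matrix m n ℝ) (E : Matrix p n ℝ) (G : Matrix q n ℝ) (X : Matrix p p ℝ)
    (S : Matrix q q ℝ) :
    R * (Eᵀ * X * E + Gᵀ * S * G) * Rᵀ =
      (R * Eᵀ) * X * (R * Eᵀ)ᵀ + (R * Gᵀ) * S * (R * Gᵀ)ᵀ := by
  simp only [transpose_mul, transpose_transpose, Matrix.mul_add, Matrix.add_mul, Matrix.mul_assoc]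

/-- The moment relaxation of a stable system is feasible: take `w = ŵ`, uncorrelated with the
stationary state. -/
theorem IsStable.exists_momentFeasible {A : Matrix ι ι ℝ} (hA : IsStable A) (B : Matrix ι κ ℝ)
    {S : Matrix κ κ ℝ} (hS : S.PosSemidef) (γ : ℝ) :
    ∃ M, MomentFeasible momentSetCor A B S γ M := by
  obtain ⟨X, hX, hlyap⟩ := hA.exists_lyapunov (hS.mul_mul_conjTranspose_same B)
  rw [conjTranspose_eq_transpose_of_trivial] at hlyap
  set E := rowState ι κ with hE
  set G : Matrix κ (ι ⊕ κ ⊕ κ) ℝ := fromCols 0 (fromCols 1 1) with hG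
  refine ⟨Eᵀ * X * E + Gᵀ * S * G, trivial, ?_, ?_, ?_, ?_⟩
  · rw [congruence_add_congruence, congruence_add_congruence]
    simp only [hE, hG, rowState, rowDyn, transpose_fromCols, fromCols_mul_fromRows]
    simpa [add_comm] using hlyap
  · rw [trace_transport_eq, congruence_add_congruence]
    simp only [hE, hG, rowState, rowDiff, rowDist, rowNom, transpose_fromCols, Matrix.sub_mul,
      fromCols_mul_fromRows]
    simp [sq_nonneg]
  · rw [congruence_add_congruence]
    simp only [hE, hG, rowState, rowNom, transpose_fromCols, fromCols_mul_fromRows]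
    simp
  · simpa using (hX.conjTranspose_mul_mul_same E).add (hS.conjTranspose_mul_mul_same G)

end Slater
end DRControl

namespace DRControl

/-! ### Weak duality, and strong duality by separation. -/

section Duality

variable {ι κ ζ : Type*} [Fintype ι] [DecidableEq ι] [Fintype κ] [DecidableEq κ]
  [Fintype ζ] [DecidableEq ζ]

/-- The square matrices, not necessarily symmetric, with positive definite quadratic form. -/
def posForms (n : Type*) [Fintype n] : Set (Matrix n n ℝ) :=
  {Y | ∀ x : n → ℝ, x ≠ 0 → 0 < x ⬝ᵥ (Y *ᵥ x)}

/-- By homogeneity positivity need only be tested on the compact unit sphere. Dropping symmetry is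
what makes the set open in the space of all matrices. -/
theorem isOpen_posForms (n : Type*) [Fintype n] : IsOpen (posForms n) := by
  rw [isOpen_iff_eventually]
  intro Y₀ hY₀
  have hc : Continuous fun p : Matrix n n ℝ × (n → ℝ) => p.2 ⬝ᵥ (p.1 *ᵥ p.2) := by fun_prop
  have hev : ∀ᶠ Y in 𝓝 Y₀, ∀ x ∈ Metric.sphere (0 : n → ℝ) 1, 0 < x ⬝ᵥ (Y *ᵥ x) := by
    refine (isCompact_sphere _ _).eventually_forall_of_forall_eventually fun x hx => ?_
    exact hc.continuousAt.eventually
      (lt_mem_nhds (hY₀ x (ne_zero_of_mem_unit_sphere ⟨x, hx⟩)))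
  filter_upwards [hev] with Y hY x hx
  have hn : 0 < ‖x‖ := norm_pos_iff.2 hx
  have h := hY (‖x‖⁻¹ • x) (by simp [norm_smul, hn.ne'])
  rw [mulVec_smul, dotProduct_smul, smul_dotProduct, smul_eq_mul, smul_eq_mul] at h
  exact pos_of_mul_pos_right (pos_of_mul_pos_right h (by positivity)) (by positivity)

theorem mem_posForms_of_posDef {n : Type*} [Fintype n] {Y : Matrix n n ℝ} (hY : Y.PosDef) :
    Y ∈ posForms n := fun x hx => by simpa using hY.dotProduct_mulVec_pos hx

theorem convex_posForms (n : Type*) [Fintype n] : Convex ℝ (posForms n) := by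
  intro Y hY Z hZ a b ha hb hab x hx
  rw [add_mulVec, smul_mulVec, smul_mulVec, dotProduct_add, dotProduct_smul, dotProduct_smul]
  exact convex_Ioi (0 : ℝ) (hY x hx) (hZ x hx) ha hb hab

/-- Linear functionals on matrices are represented by the trace pairing. -/
theorem exists_trace_eq {n : Type*} [Fintype n] [DecidableEq n] (f : Matrix n n ℝ →ₗ[ℝ] ℝ) :
    ∃ M : Matrix n n ℝ, ∀ Z, f Z = trace (M * Z) := by
  refine ⟨of fun j i => f (single i j 1), fun Z => ?_⟩
  conv_lhs => rw [matrix_eq_sum_single Z]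
  simp only [map_sum, trace, diag, mul_apply, of_apply]
  rw [Finset.sum_comm]
  refine Finset.sum_congr rfl fun i _ => Finset.sum_congr rfl fun j _ => ?_
  rw [show single j i (Z j i) = Z j i • single j i (1 : ℝ) by simp, map_smul, smul_eq_mul, mul_comm]

theorem trace_symmetrize_mul {n : Type*} [Fintype n] (M : Matrix n n ℝ) {Z : Matrix n n ℝ}
    (hZ : Z.IsSymm) : trace (((1 / 2 : ℝ) • (M + Mᵀ)) * Z) = trace (M * Z) := by
  have : trace (Mᵀ * Z) = trace (M * Z) := by
    rw [← trace_transpose, transpose_mul, transpose_transpose, hZ.eq, trace_mul_comm]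
  rw [Matrix.smul_mul, trace_smul, Matrix.add_mul, trace_add, this, smul_eq_mul]
  ring

theorem trace_mul_nonneg_of_posSemidef {n : Type*} [Fintype n] [DecidableEq n]
    {M Y : Matrix n n ℝ}
    (hM : M.PosSemidef) (hY : Y.PosSemidef) : 0 ≤ trace (M * Y) := by
  obtain ⟨G, rfl⟩ := by
    open scoped MatrixOrder in exact CStarAlgebra.nonneg_iff_eq_star_mul_self.1 hY.nonneg
  rw [star_eq_conjTranspose, conjTranspose_eq_transpose_of_trivial, trace_mul_gram]
  simpa using (hM.mul_mul_conjTranspose_same G).trace_nonneg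

/-- Small `t` gives the first sign, large `t` the second. This is how signs are read off the
separating functional. -/
theorem nonneg_of_forall_pos_add_mul_nonneg {a b : ℝ} (h : ∀ t : ℝ, 0 < t → 0 ≤ a + t * b) :
    0 ≤ a ∧ 0 ≤ b := by
  constructor
  · by_contra! ha
    rcases le_or_gt b 0 with hb | hb
    · have := h 1 one_pos
      linarith
    · have := h (-a / (2 * b)) (div_pos (by linarith) (by linarith))
      have e : -a / (2 * b) * b = -a / 2 := by field_simp
      linarith
  · by_contra! hb
    have := h ((|a| + 1) / (-b)) (div_pos (by positivity) (by linarith))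
    have e : (|a| + 1) / (-b) * b = -(|a| + 1) := by
      rw [div_neg, neg_mul, div_mul_cancel₀ _ hb.ne]
    linarith [le_abs_self a]

theorem eq_zero_of_forall_add_mul_nonneg {a b : ℝ} (h : ∀ t : ℝ, 0 ≤ a + t * b) : b = 0 := by
  have h₁ := (nonneg_of_forall_pos_add_mul_nonneg fun t _ => h t).2
  have h₂ := (nonneg_of_forall_pos_add_mul_nonneg (a := a) (b := -b) fun t _ => by
    simpa using h (-t)).2
  linarith

/-- A symmetric matrix is zero if its trace pairing with every symmetric matrix vanishes. -/
theorem eq_zero_of_forall_trace_mul_eq_zero {n : Type*} [Fintype n] {N : Matrix n n ℝ}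
    (hN : N.IsSymm) (h : ∀ P : Matrix n n ℝ, P.IsSymm → trace (P * N) = 0) : N = 0 := by
  rw [← trace_conjTranspose_mul_self_eq_zero_iff, conjTranspose_eq_transpose_of_trivial, hN.eq]
  exact h N hN

theorem weak_duality {A : Matrix ι ι ℝ} {B : Matrix ι κ ℝ} {C : Matrix ζ ι ℝ} {D : Matrix ζ κ ℝ}
    {S : Matrix κ κ ℝ} {γ l : ℝ} {P : Matrix ι ι ℝ} {Q : Matrix κ κ ℝ}
    {M : Matrix (ι ⊕ κ ⊕ κ) (ι ⊕ κ ⊕ κ) ℝ} (hM : MomentFeasible momentSetCor A B S γ M)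
    (hd : DualFeasible A B C D l P Q) : momentObjective C D M ≤ dualObjective S γ l Q := by
  have h₁ := trace_mul_nonneg_of_posSemidef hM.posSemidef hd.lmi.posSemidef
  rw [Matrix.mul_neg, trace_neg] at h₁
  have h₂ := trace_mul_lmi A B C D l P Q M
  rw [lmi] at h₂
  rw [h₂, hM.stationary, sub_self, Matrix.mul_zero, trace_zero, ← hM.nominal] at h₁
  have h₃ := hM.transport
  rw [trace_transport_eq] at h₃
  have h₄ := mul_le_mul_of_nonneg_left h₃ hd.nonneg
  rw [dualObjective]
  linarith

/-- The pairs `(Z, t)` with `lmi ≺ Z` and `dualObjective < t` for some dual variables. -/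
def dualEpigraph (A : Matrix ι ι ℝ) (B : Matrix ι κ ℝ) (C : Matrix ζ ι ℝ) (D : Matrix ζ κ ℝ)
    (S : Matrix κ κ ℝ) (γ : ℝ) : Set (Matrix (ι ⊕ κ ⊕ κ) (ι ⊕ κ ⊕ κ) ℝ × ℝ) :=
  {p | ∃ (l : ℝ) (P : Matrix ι ι ℝ) (Q : Matrix κ κ ℝ), 0 ≤ l ∧ P.IsSymm ∧ Q.IsSymm ∧
    p.1 - lmi A B C D l P Q ∈ posForms _ ∧ dualObjective S γ l Q < p.2}

theorem isOpen_dualEpigraph (A : Matrix ι ι ℝ) (B : Matrix ι κ ℝ) (C : Matrix ζ ι ℝ)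
    (D : Matrix ζ κ ℝ) (S : Matrix κ κ ℝ) (γ : ℝ) : IsOpen (dualEpigraph A B C D S γ) := by
  simp only [dualEpigraph, Set.ofPred_exists, Set.ofPred_and]
  refine isOpen_iUnion fun l => isOpen_iUnion fun P => isOpen_iUnion fun Q =>
    isOpen_const.inter <| isOpen_const.inter <| isOpen_const.inter <| IsOpen.inter ?_ ?_
  · exact (isOpen_posForms _).preimage (continuous_fst.sub continuous_const)
  · exact isOpen_lt continuous_const continuous_snd

theorem convex_dualEpigraph (A : Matrix ι ι ℝ) (B : Matrix ι κ ℝ) (C : Matrix ζ ι ℝ)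
    (D : Matrix ζ κ ℝ) (S : Matrix κ κ ℝ) (γ : ℝ) : Convex ℝ (dualEpigraph A B C D S γ) := by
  rintro ⟨Z, t⟩ ⟨l, P, Q, hl, hP, hQ, hZ, ht⟩ ⟨Z', t'⟩ ⟨l', P', Q', hl', hP', hQ', hZ', ht'⟩
    a b ha hb hab
  refine ⟨a * l + b * l', a • P + b • P', a • Q + b • Q', by positivity,
    (hP.smul a).add (hP'.smul b), (hQ.smul a).add (hQ'.smul b), ?_, ?_⟩
  · rw [lmi_combination _ _ _ _ _ _ _ _ _ _ hab]
    convert convex_posForms _ hZ hZ' ha hb hab using 1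
    simp only [Prod.fst_add, Prod.smul_fst]
    module
  · have h := convex_Ioi (0 : ℝ) (sub_pos.2 ht) (sub_pos.2 ht') ha hb hab
    simp only [Set.mem_Ioi, smul_eq_mul, dualObjective, Prod.snd_add, Prod.smul_snd,
      Matrix.add_mul, Matrix.smul_mul, trace_add, trace_smul] at h ⊢
    linarith

/-- If the dual analysis problem is feasible and bounded below by `v`, then the moment relaxation
has a feasible point of objective value at least `v`. -/
theorem exists_momentFeasible_of_forall_le {A : Matrix ι ι ℝ} {B : Matrix ι κ ℝ}
    {C : Matrix ζ ι ℝ} {D : Matrix ζ κ ℝ} {S : Matrix κ κ ℝ} (hS : S.IsSymm) {γ v : ℝ}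
    (hfeas : ∃ (l : ℝ) (P : Matrix ι ι ℝ) (Q : Matrix κ κ ℝ), DualFeasible A B C D l P Q)
    (hv : ∀ l P Q, DualFeasible A B C D l P Q → v ≤ dualObjective S γ l Q) :
    ∃ M, MomentFeasible momentSetCor A B S γ M ∧ v ≤ momentObjective C D M := by
  have hnot : ((0 : Matrix (ι ⊕ κ ⊕ κ) (ι ⊕ κ ⊕ κ) ℝ), v) ∉ dualEpigraph A B C D S γ := by
    rintro ⟨l, P, Q, hl, hP, hQ, hZ, ht⟩
    refine (hv l P Q ⟨hl, hP, hQ, .of_dotProduct_mulVec_pos ?_ fun x hx => ?_⟩).not_gt ht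
    · rw [IsHermitian, conjTranspose_eq_transpose_of_trivial, transpose_neg]
      exact congrArg Neg.neg (lmi_isSymm A B C D _ hP hQ).eq
    · rw [zero_sub] at hZ
      exact hZ x hx
  obtain ⟨f, hf⟩ := geometric_hahn_banach_open_point (convex_dualEpigraph A B C D S γ)
    (isOpen_dualEpigraph A B C D S γ) hnot
  obtain ⟨M₀, hM₀⟩ := exists_trace_eq (-(f.toLinearMap ∘ₗ LinearMap.inl ℝ _ ℝ))
  set μ : ℝ := -f (0, 1) with hμ
  have hfe : ∀ Z t, f (Z, t) = -(trace (M₀ * Z) + t * μ) := by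
    intro Z t
    have h₁ : (Z, t) = (Z, (0 : ℝ)) + t • ((0 : Matrix (ι ⊕ κ ⊕ κ) (ι ⊕ κ ⊕ κ) ℝ), (1 : ℝ)) := by
      simp
    have h₂ : -f (Z, 0) = trace (M₀ * Z) := hM₀ Z
    rw [h₁, map_add, map_smul, smul_eq_mul, ← h₂, hμ]
    ring
  -- The functional acts on all matrices but is tested only on symmetric ones, so its representative
  -- may be symmetrized.
  set M : Matrix (ι ⊕ κ ⊕ κ) (ι ⊕ κ ⊕ κ) ℝ := (1 / 2 : ℝ) • (M₀ + M₀ᵀ) with hM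
  have hMs : Mᵀ = M := by simp [hM, add_comm]
  have hstrict : ∀ l P Q Y r, 0 ≤ l → P.IsSymm → Q.IsSymm → Y.PosDef → 0 < r →
      v * μ < trace (M * (lmi A B C D l P Q + Y)) + (dualObjective S γ l Q + r) * μ := by
    intro l P Q Y r hl hP hQ hY hr
    have h := hf (lmi A B C D l P Q + Y, dualObjective S γ l Q + r)
      ⟨l, P, Q, hl, hP, hQ, by simpa using mem_posForms_of_posDef hY, by simpa using hr⟩
    have hYs : Y.IsSymm := by simpa [IsHermitian, IsSymm] using hY.1
    rw [hfe, hfe, Matrix.mul_zero, trace_zero,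
      ← trace_symmetrize_mul _ ((lmi_isSymm A B C D l hP hQ).add hYs)] at h
    linarith
  -- The strict inequality at `Y + t • 1` and `r + t`, as `t` tends to zero, reaches semidefinite
  -- `Y` and `r = 0`.
  have hweak : ∀ l P Q Y r, 0 ≤ l → P.IsSymm → Q.IsSymm → Y.PosSemidef → 0 ≤ r →
      0 ≤ trace (M * lmi A B C D l P Q) + trace (M * Y) + (dualObjective S γ l Q + r) * μ
        - v * μ := by
    intro l P Q Y r hl hP hQ hY hr
    refine (nonneg_of_forall_pos_add_mul_nonneg (b := trace M + μ) fun t ht => ?_).1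
    have h := hstrict l P Q (Y + t • 1) (r + t) hl hP hQ
      (PosDef.posSemidef_add hY (PosDef.one.smul ht)) (by positivity)
    rw [Matrix.mul_add, Matrix.mul_add, Matrix.mul_smul, Matrix.mul_one, trace_add, trace_add,
      trace_smul, smul_eq_mul] at h
    linarith
  obtain ⟨l₀, P₀, Q₀, hd₀⟩ := hfeas
  have hμ0 : 0 ≤ μ := by
    refine (nonneg_of_forall_pos_add_mul_nonneg (a := trace (M * lmi A B C D l₀ P₀ Q₀)
      + dualObjective S γ l₀ Q₀ * μ - v * μ) fun t ht => ?_).2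
    have h := hweak l₀ P₀ Q₀ 0 t hd₀.nonneg hd₀.symm_P hd₀.symm_Q .zero ht.le
    rw [Matrix.mul_zero, trace_zero] at h
    linarith
  -- Slater's condition: with `Y = -lmi` at the strictly feasible point the matrix argument is zero,
  -- so `μ = 0` would give `0 < 0`.
  have hμpos : 0 < μ := by
    refine lt_of_le_of_ne hμ0 fun h0 => ?_
    have h := hstrict l₀ P₀ Q₀ _ 1 hd₀.nonneg hd₀.symm_P hd₀.symm_Q hd₀.lmi one_pos
    rw [← h0, lmi, add_neg_cancel] at h
    simp at h
  -- Testing with large multiples of the rank-one matrix `x xᵀ` isolates the quadratic form of `M`.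
  have hMpos : M.PosSemidef := by
    refine .of_dotProduct_mulVec_nonneg (by simpa [IsHermitian] using hMs) fun x => ?_
    refine (nonneg_of_forall_pos_add_mul_nonneg (a := trace (M * lmi A B C D l₀ P₀ Q₀)
      + dualObjective S γ l₀ Q₀ * μ - v * μ) fun t ht => ?_).2
    have h := hweak l₀ P₀ Q₀ (t • vecMulVec x (star x)) 0 hd₀.nonneg hd₀.symm_P hd₀.symm_Q
        ((posSemidef_vecMulVec_self_star x).smul ht.le) le_rfl
    rw [Matrix.mul_smul, trace_smul, smul_eq_mul, mul_vecMulVec, trace_vecMulVec,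
      dotProduct_comm] at h
    linarith
  set N := μ⁻¹ • M with hN
  -- The Lagrangian at `N`, minus `v`, is nonnegative for all multipliers. The free `P` and `Q`
  -- force equalities, `l ≥ 0` forces the transport inequality, and zero multipliers give the bound
  -- on the objective.
  have hlag : ∀ l P Q, 0 ≤ l → P.IsSymm → Q.IsSymm →
      0 ≤ trace (P * (rowDyn A B * N * (rowDyn A B)ᵀ - rowState ι κ * N * (rowState ι κ)ᵀ))
        + (momentObjective C D N - v)
        + l * (γ ^ 2 - trace (rowDiff ι κ * N * (rowDiff ι κ)ᵀ))
        + trace (Q * (S - rowNom ι κ * N * (rowNom ι κ)ᵀ)) := by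
    intro l P Q hl hP hQ
    have h := hweak l P Q 0 0 hl hP hQ .zero le_rfl
    have hN' : M = μ • N := by rw [hN, smul_smul, mul_inv_cancel₀ hμpos.ne', one_smul]
    rw [hN', Matrix.smul_mul, trace_smul, smul_eq_mul, trace_mul_lmi, Matrix.mul_zero,
      trace_zero] at h
    rw [Matrix.mul_sub Q, trace_sub]
    refine le_of_mul_le_mul_left ?_ hμpos
    rw [dualObjective] at h
    linarith
  have hNs : Nᵀ = N := by rw [hN, transpose_smul, hMs]
  refine ⟨N, ⟨trivial, ?_, ?_, ?_, hMpos.smul (inv_nonneg.2 hμ0)⟩, ?_⟩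
  · refine (sub_eq_zero.1 (eq_zero_of_forall_trace_mul_eq_zero ?_ fun P hP => ?_)).symm
    · simp only [IsSymm, transpose_sub, transpose_mul, transpose_transpose, hNs, Matrix.mul_assoc]
    · refine eq_zero_of_forall_add_mul_nonneg (a := momentObjective C D N - v) fun t => ?_
      have h := hlag 0 (t • P) 0 le_rfl (hP.smul t) isSymm_zero
      rw [Matrix.smul_mul, trace_smul, smul_eq_mul, Matrix.zero_mul, trace_zero] at h
      linarith
  · rw [trace_transport_eq]
    refine sub_nonneg.1 (nonneg_of_forall_pos_add_mul_nonneg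
      (a := momentObjective C D N - v) fun t ht => ?_).2
    simpa using hlag t 0 0 ht.le isSymm_zero isSymm_zero
  · refine sub_eq_zero.1 (eq_zero_of_forall_trace_mul_eq_zero ?_ fun Q hQ => ?_)
    · simp only [IsSymm, transpose_sub, transpose_mul, transpose_transpose, hNs, hS.eq,
        Matrix.mul_assoc]
    · refine eq_zero_of_forall_add_mul_nonneg (a := momentObjective C D N - v) fun t => ?_
      have h := hlag 0 0 (t • Q) le_rfl isSymm_zero (hQ.smul t)
      rw [Matrix.smul_mul, trace_smul, smul_eq_mul, Matrix.zero_mul, trace_zero] at h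
      linarith
  · simpa using hlag 0 0 0 le_rfl isSymm_zero isSymm_zero

end Duality
end DRControl

theorem mainTheorem4 {ι κ ζ : Type*} [Fintype ι] [DecidableEq ι] [Fintype κ] [DecidableEq κ]
    [Fintype ζ] [DecidableEq ζ]
    (A : Matrix ι ι ℝ) (B : Matrix ι κ ℝ) (C : Matrix ζ ι ℝ) (D : Matrix ζ κ ℝ)
    (hA : DRControl.IsStable A)
    (Pnom : MeasureTheory.Measure (EuclideanSpace ℝ κ))
    (hGauss : ProbabilityTheory.IsGaussian Pnom)
    (hmean : ∫ v, v ∂Pnom = 0)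
    (γ : ℝ) :
    (∃ val : ℝ,
      IsLUB {c : ℝ | ∃ M : Matrix (ι ⊕ κ ⊕ κ) (ι ⊕ κ ⊕ κ) ℝ,
        DRControl.MomentFeasible DRControl.momentSetCor A B (DRControl.secondMoment Pnom) γ M ∧
          c = DRControl.momentObjective C D M} val ∧
      IsGLB {c : ℝ | ∃ (l : ℝ) (P : Matrix ι ι ℝ) (Q : Matrix κ κ ℝ),
        DRControl.DualFeasible A B C D l P Q ∧
          c = DRControl.dualObjective (DRControl.secondMoment Pnom) γ l Q} val) ∧
    ∃ (l : ℝ) (P : Matrix ι ι ℝ) (Q : Matrix κ κ ℝ), DRControl.DualFeasible A B C D l P Q := by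
  open DRControl in
  have hS := posSemidef_secondMoment Pnom
  have hSs : (secondMoment Pnom).IsSymm := by simpa [IsHermitian, IsSymm] using hS.1
  obtain ⟨M₀, hM₀⟩ := hA.exists_momentFeasible B hS γ
  have hdual := hA.exists_dualFeasible B C D
  refine ⟨?_, hdual⟩
  obtain ⟨l₀, P₀, Q₀, hd₀⟩ := id hdual
  obtain ⟨v, hv⟩ := Real.exists_isGLB (s := {c : ℝ | ∃ (l : ℝ) (P : Matrix ι ι ℝ)
    (Q : Matrix κ κ ℝ), DualFeasible A B C D l P Q ∧
      c = dualObjective (secondMoment Pnom) γ l Q}) ⟨_, l₀, P₀, Q₀, hd₀, rfl⟩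
    ⟨momentObjective C D M₀, by
      rintro _ ⟨l, P, Q, hd, rfl⟩
      exact weak_duality hM₀ hd⟩
  refine ⟨v, ⟨?_, fun b hb => ?_⟩, hv⟩
  · rintro _ ⟨M, hM, rfl⟩
    refine hv.2 ?_
    rintro _ ⟨l, P, Q, hd, rfl⟩
    exact weak_duality hM hd
  -- Separation at the dual infimum itself yields a moment matrix attaining that value.
  · obtain ⟨M, hM, hle⟩ := exists_momentFeasible_of_forall_le hSs hdual
      fun l P Q hd => hv.1 ⟨l, P, Q, hd, rfl⟩
    exact hle.trans (hb ⟨M, hM, rfl⟩)
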